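/- Let $X$ be a metric space, let $\dim X\in\{-1,0,1,2,\dots,\infty\}$ be its Lebesgue covering dimension, and let $n\ge 0$ be an integer. Here $\dim X\le n$ means that every open cover of $X$ is refined by an open cover of $X$ such that no point lies in more than $n+1$ of its members, and $\dim\emptyset=-1$. Let $\mathcal{O}$ be the collection of all open covers of $X$. For an integer $k\ge 0$ let ${\sf G}_c^{k}(\mathcal{O},\mathcal{O})$ be the following game with innings $l=0,1,\dots,k-1$: in inning $l$, player ONE first chooses an open cover $\mathcal{O}_l\in\mathcal{O}$, and then player TWO responds with a pairwise disjoint family $\mathcal{T}_l$ of subsets of $X$ that refines $\mathcal{O}_l$ (every member of $\mathcal{T}_l$ is contained in some member of $\mathcal{O}_l$). TWO wins the play if $\bigcup_{l<k}\mathcal{T}_l$ is an open cover of $X$; otherwise ONE wins. (In particular, TWO wins ${\sf G}_c^{0}(\mathcal{O},\mathcal{O})$ if and only if $X=\emptyset$.) Theorem (Babinkostova). 1. $\dim X\le n$ if and only if TWO has a winning strategy in ${\sf G}_c^{n+1}(\mathcal{O},\mathcal{O})$. 2. $\dim X= n$ if and only if TWO has a winning strategy in ${\sf G}_c^{n+1}(\mathcal{O},\mathcal{O})$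 but not in ${\sf G}_c^{n}(\mathcal{O},\mathcal{O})$. -/

import Mathlib

/-- `𝒱` refines `𝒰`: every member of `𝒱` is contained in some member of `𝒰`. -/
def Refines {S : Type*} (𝒱 𝒰 : Set (Set S)) : Prop :=
  ∀ V ∈ 𝒱, ∃ U ∈ 𝒰, V ⊆ U

/-- The collection of all open covers of the space `X`. -/
def openCovers (X : Type*) [TopologicalSpace X] : Set (Set (Set X)) :=
  {𝒰 | (∀ U ∈ 𝒰, IsOpen U) ∧ ⋃₀ 𝒰 = Set.univ}

/-- `dim X < n` for the (Lebesgue) covering dimension: every open cover of `X` has a refinement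
that is an open cover of `X` and has no point in more than `n` members.
For `n = 0` this says that `X` is empty. -/
def HasCoveringDimensionLT (X : Type*) [TopologicalSpace X] (n : ℕ) : Prop :=
  ∀ 𝒰 ∈ openCovers X, ∃ 𝒱 ∈ openCovers X, Refines 𝒱 𝒰 ∧
    ∀ x : X, {V ∈ 𝒱 | x ∈ V}.encard ≤ n

/-- The (Lebesgue) covering dimension of `X`, as an element of `{-1, 0, 1, 2, …, ∞}`, where
`⊥` stands for `-1` and is the dimension of the empty space. -/
noncomputable def coveringDimension (X : Type*) [TopologicalSpace X] : WithBot ℕ∞ :=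
  sInf {d | ∀ n : ℕ, d < n → HasCoveringDimensionLT X n}

theorem HasCoveringDimensionLT.mono {X : Type*} [TopologicalSpace X] {m n : ℕ} (hmn : m ≤ n)
    (h : HasCoveringDimensionLT X m) : HasCoveringDimensionLT X n := by
  intro 𝒰 h𝒰
  obtain ⟨𝒱, h1, h2, h3⟩ := h 𝒰 h𝒰
  exact ⟨𝒱, h1, h2, fun x => (h3 x).trans (by exact_mod_cast hmn)⟩

theorem coveringDimension_lt_iff {X : Type*} [TopologicalSpace X] {n : ℕ} :
    coveringDimension X < n ↔ HasCoveringDimensionLT X n := by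
  constructor
  · intro h
    obtain ⟨d, hd, hdn⟩ := sInf_lt_iff.1 h
    exact hd n hdn
  · intro h
    cases n with
    | zero =>
      refine lt_of_le_of_lt (b := ⊥) (sInf_le ?_) (WithBot.bot_lt_coe _)
      intro m _
      exact h.mono (Nat.zero_le m)
    | succ k =>
      refine lt_of_le_of_lt (b := (k : WithBot ℕ∞)) (sInf_le ?_) (by
        exact_mod_cast Nat.lt_succ_self k)
      intro m hm
      have hkm : k < m := by exact_mod_cast hm
      exact h.mono hkm

/-- TWO's strategies in a game whose innings are indexed by `ι` and in which ONE plays elements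
of `M` and TWO plays elements of `N`: in inning `l`, TWO's move is a function of the moves that
ONE has made in the innings `j ≤ l`. -/
abbrev StrategyOfTwo (ι : Type*) [LinearOrder ι] (M N : Type*) :=
  (l : ι) → (Set.Iic l → M) → N

/-- `σ` is a winning strategy of TWO in the game `G_c(𝒜, ℬ)` with innings indexed by `ι`:
in inning `l` ONE chooses `O l ∈ 𝒜`, and TWO responds with a pairwise disjoint family `T l`
that refines `O l`; TWO wins the play if `⋃ l, T l ∈ ℬ`.  Whatever ONE plays, the responses
given by `σ` are legal and the resulting play is won by TWO. -/
def IsWinningStrategyGc {S : Type*} (ι : Type*) [LinearOrder ι] (𝒜 ℬ : Set (Set (Set S)))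
    (σ : StrategyOfTwo ι (Set (Set S)) (Set (Set S))) : Prop :=
  ∀ O : ι → Set (Set S), (∀ l, O l ∈ 𝒜) →
    (∀ l, (σ l fun j => O j).PairwiseDisjoint id ∧ Refines (σ l fun j => O j) (O l)) ∧
      (⋃ l, σ l fun j => O j) ∈ ℬ

/-- TWO has a winning strategy in the game `G_c^k(𝒜, ℬ)` of finite length `k`,
with innings `0, …, k - 1`. -/
def TwoWinsGc {S : Type*} (k : ℕ) (𝒜 ℬ : Set (Set (Set S))) : Prop :=
  ∃ σ, IsWinningStrategyGc (Fin k) 𝒜 ℬ σ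

/-!
The heart of the matter is that `dim X < k` is equivalent to TWO winning the game of length `k`.

If TWO wins, let ONE play the same open cover in every inning. The union of TWO's answers is an
open refinement, and each of the `k` disjoint families contributes at most one member containing a
given point (`TwoWinsGc.hasCoveringDimensionLT`).

Conversely, let `dim X < k`. It is enough to write `X` as the union of `k` sets, the `l`-th of which
can be covered by a disjoint open family refining any prescribed open cover of `X`: in inning `l` TWO
takes care of the `l`-th set, whatever happened before. These sets come from `k` sequences of
equivalence relations on `X`, one for each colour `l`. The relations of each sequence decrease, their
classes have diameters tending to `0`, and every point has, for a suitable colour, only open classes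
(`HasCoveringDimensionLT.exists_equivalences`). Given an open cover, the classes that are maximal
among those contained in a member of the cover are pairwise disjoint.

The equivalence relations are constructed as follows. A partition of unity `f` subordinate to an open
cover of order at most `k` yields `k` families of open sets which together cover `X`: the family of
colour `l` consists of the sets, one for each set `A` of `l + 1` indices, on which every `f s` with
`s ∈ A` exceeds all other `f t` by a fixed amount. Sets of the same colour are uniformly far apart
in the pseudometric `sup_s |f s x - f s y|` (`HasCoveringDimensionLT.exists_separated_families`).
Iterating this, one gets families `T i l` and pseudometrics `D i` such that `T i l` is very fine for
`D i`, and its members are separated by `D (i + 1)`. The `i`-th relation of colour `l` connects two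
points if they are joined by a chain of members of `T j l`, `j ≥ i`. Such a chain contains at most
one member of level `i`, because the pieces of the chain at the levels above `i` are too short to
connect two different ones; hence the whole chain is short (`ChainRel.le_of_separated`).
-/

open Topology Filter

/-! ### Separated families from a partition of unity -/

/-- A pseudometric on a topological space all of whose balls are neighbourhoods of their centres. -/
structure IsContinuousPseudometric {X : Type*} [TopologicalSpace X] (D : X → X → ℝ) : Prop where
  self : ∀ x, D x x = 0
  symm : ∀ x y, D x y = D y x
  triangle : ∀ x y z, D x z ≤ D x y + D y z
  eventually_lt : ∀ x, ∀ ε > 0, ∀ᶠ y in 𝓝 x, D x y < ε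

theorem isContinuousPseudometric_dist {X : Type*} [PseudoMetricSpace X] :
    IsContinuousPseudometric (dist : X → X → ℝ) where
  self := dist_self
  symm := dist_comm
  triangle := dist_triangle
  eventually_lt x ε hε := by
    filter_upwards [Metric.ball_mem_nhds x hε] with y hy
    rwa [dist_comm]

theorem IsContinuousPseudometric.max {X : Type*} [TopologicalSpace X] {D E : X → X → ℝ}
    (hD : IsContinuousPseudometric D) (hE : IsContinuousPseudometric E) :
    IsContinuousPseudometric fun x y => max (D x y) (E x y) where
  self x := by simp [hD.self, hE.self]
  symm x y := by simp only [hD.symm x y, hE.symm x y]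
  triangle x y z := max_le
    ((hD.triangle x y z).trans (add_le_add (le_max_left _ _) (le_max_left _ _)))
    ((hE.triangle x y z).trans (add_le_add (le_max_right _ _) (le_max_right _ _)))
  eventually_lt x ε hε := by
    filter_upwards [hD.eventually_lt x ε hε, hE.eventually_lt x ε hε] with y h1 h2
    exact max_lt h1 h2

theorem IsContinuousPseudometric.div_const {X : Type*} [TopologicalSpace X] {D : X → X → ℝ}
    (hD : IsContinuousPseudometric D) {c : ℝ} (hc : 0 < c) :
    IsContinuousPseudometric fun x y => D x y / c where
  self x := by simp [hD.self]
  symm x y := by simp only [hD.symm x y]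
  triangle x y z := by
    rw [← add_div]
    exact div_le_div_of_nonneg_right (hD.triangle x y z) hc.le
  eventually_lt x ε hε := by
    filter_upwards [hD.eventually_lt x (ε * c) (mul_pos hε hc)] with y hy
    exact (div_lt_iff₀ hc).2 hy

namespace PartitionOfUnity

variable {ι X : Type*} [TopologicalSpace X] (f : PartitionOfUnity ι X)

theorem eventually_forall_abs_sub_lt (x : X) {ε : ℝ} (hε : 0 < ε) :
    ∀ᶠ y in 𝓝 x, ∀ i, |f i x - f i y| < ε := by
  obtain ⟨t, ht, hfin⟩ := f.locallyFinite x
  have hev : ∀ᶠ y in 𝓝 x, ∀ i ∈ {i | (Function.support (f i) ∩ t).Nonempty},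
      |f i x - f i y| < ε := by
    refine (eventually_all_finite hfin).2 fun i _ => ?_
    have := Metric.tendsto_nhds.1 ((f i).continuous.tendsto x) ε hε
    filter_upwards [this] with y hy
    rwa [abs_sub_comm, ← Real.dist_eq]
  filter_upwards [hev, ht] with y hy hyt i
  by_cases hi : (Function.support (f i) ∩ t).Nonempty
  · exact hy i hi
  · have hzero : ∀ z ∈ t, f i z = 0 := fun z hz => by
      by_contra hne
      exact hi ⟨z, hne, hz⟩
    rw [hzero x (mem_of_mem_nhds ht), hzero y hyt]
    simpa using hε

/-- The pseudometric induced by the map `x ↦ (f i x)_i` from the supremum distance. -/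
noncomputable def supDist (x y : X) : ℝ := ⨆ i, |f i x - f i y|

theorem abs_sub_le_supDist (x y : X) (i : ι) : |f i x - f i y| ≤ f.supDist x y := by
  refine le_ciSup (f := fun i => |f i x - f i y|) ⟨1, ?_⟩ i
  rintro _ ⟨j, rfl⟩
  exact abs_le.2 ⟨by linarith [f.nonneg j x, f.le_one j y], by
    linarith [f.nonneg j y, f.le_one j x]⟩

theorem isContinuousPseudometric_supDist : IsContinuousPseudometric f.supDist where
  self x := by simp [supDist]
  symm x y := by simp only [supDist, abs_sub_comm]
  triangle x y z := by
    refine Real.iSup_le (fun i => ?_) (add_nonneg (Real.iSup_nonneg fun i => abs_nonneg _)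
      (Real.iSup_nonneg fun i => abs_nonneg _))
    exact (abs_sub_le _ _ _).trans
      (add_le_add (f.abs_sub_le_supDist x y i) (f.abs_sub_le_supDist y z i))
  eventually_lt x ε hε := by
    filter_upwards [f.eventually_forall_abs_sub_lt x (half_pos hε)] with y hy
    exact (Real.iSup_le (fun i => (hy i).le) (half_pos hε).le).trans_lt (half_lt_self hε)

/-- The set of points at which the functions with index in `A` are at least `η` and exceed all
other functions by at least `η`. -/
def dominantSet (η : ℝ) (A : Finset ι) : Set X :=
  {x | ∀ s ∈ A, η ≤ f s x ∧ ∀ t ∉ A, f t x + η ≤ f s x}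

theorem dominantSet_subset_interior {η : ℝ} (hη : 0 < η) (A : Finset ι) :
    f.dominantSet (2 * η) A ⊆ interior (f.dominantSet η A) := by
  intro x hx
  rw [mem_interior_iff_mem_nhds]
  filter_upwards [f.eventually_forall_abs_sub_lt x (half_pos hη)] with y hy s hs
  have h1 := abs_lt.1 (hy s)
  refine ⟨by linarith [(hx s hs).1], fun t ht => ?_⟩
  have h2 := abs_lt.1 (hy t)
  linarith [(hx s hs).2 t ht]

theorem le_supDist_of_mem_dominantSet {η : ℝ} {A B : Finset ι} (hcard : A.card = B.card)
    (hne : A ≠ B) {x y : X} (hx : x ∈ f.dominantSet η A) (hy : y ∈ f.dominantSet η B) :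
    η ≤ f.supDist x y := by
  obtain ⟨s, hsA, hsB⟩ : ∃ s ∈ A, s ∉ B := by
    by_contra! hsub
    exact hne (Finset.eq_of_subset_of_card_le hsub hcard.ge)
  obtain ⟨t, htB, htA⟩ : ∃ t ∈ B, t ∉ A := by
    by_contra! hsub
    exact hne (Finset.eq_of_subset_of_card_le hsub hcard.le).symm
  have h1 := (hx s hsA).2 t htA
  have h2 := (hy t htB).2 s hsB
  have h3 := (abs_le.1 (f.abs_sub_le_supDist x y s)).2
  have h4 := (abs_le.1 (f.abs_sub_le_supDist x y t)).1
  linarith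

end PartitionOfUnity

/-- Among at most `k` nonnegative numbers with sum `1` there is a gap of length `c`: the `k`
intervals `(j c, (j + 1) c)`, `j < k`, cannot all contain one of the numbers, since one of the
numbers is at least `k c`. -/
theorem exists_dominant_finset {ι : Type*} {g : ι → ℝ} {S : Finset ι} {k : ℕ} {c : ℝ} (hc : 0 < c)
    (hkc : k * (k * c) ≤ 1) (hS : ∀ i ∉ S, g i = 0) (hcard : S.card ≤ k)
    (hsum : ∑ i ∈ S, g i = 1) :
    ∃ A : Finset ι, A.Nonempty ∧ A.card ≤ k ∧ ∀ s ∈ A, c ≤ g s ∧ ∀ t ∉ A, g t + c ≤ g s := by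
  classical
  obtain ⟨s₀, hs₀, hs₀c⟩ : ∃ s ∈ S, k * c ≤ g s := by
    by_contra! hlt
    have hne : S.Nonempty := by
      rw [Finset.nonempty_iff_ne_empty]
      rintro rfl
      simp at hsum
    have h1 := Finset.sum_lt_sum_of_nonempty hne hlt
    rw [hsum, Finset.sum_const, nsmul_eq_mul] at h1
    have h2 : (S.card : ℝ) * (k * c) ≤ k * (k * c) := by gcongr
    linarith
  obtain ⟨j, hj⟩ : ∃ j : Fin k, ∀ s ∈ S, g s ≤ j * c ∨ (j + 1) * c ≤ g s := by
    by_contra! hno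
    choose s hsS hs1 hs2 using hno
    have hle : ∀ i j : Fin k, s i = s j → i ≤ j := fun i j hij => by
      by_contra! hji
      have h1 : (j : ℝ) + 1 ≤ i := by exact_mod_cast hji
      have h2 := mul_le_mul_of_nonneg_right h1 hc.le
      have h3 := hs1 i
      rw [hij] at h3
      linarith [hs2 j]
    have hinj : Function.Injective s := fun i j hij =>
      le_antisymm (hle i j hij) (hle j i hij.symm)
    have himage : Finset.univ.image s = S :=
      Finset.eq_of_subset_of_card_le (Finset.image_subset_iff.2 fun i _ => hsS i)
        (by rw [Finset.card_image_of_injective _ hinj]; simpa using hcard)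
    rw [← himage] at hs₀
    obtain ⟨i, -, rfl⟩ := Finset.mem_image.1 hs₀
    have h1 : (i : ℝ) + 1 ≤ k := by exact_mod_cast i.2
    have h2 := mul_le_mul_of_nonneg_right h1 hc.le
    linarith [hs2 i]
  have hj0 : (0 : ℝ) ≤ j * c := by positivity
  refine ⟨S.filter fun s => (j + 1) * c ≤ g s, ⟨s₀, ?_⟩,
    (Finset.card_filter_le _ _).trans hcard, fun s hs => ?_⟩
  · have h1 : (j : ℝ) + 1 ≤ k := by exact_mod_cast j.2
    exact Finset.mem_filter.2 ⟨hs₀, (mul_le_mul_of_nonneg_right h1 hc.le).trans hs₀c⟩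
  · have hgs := (Finset.mem_filter.1 hs).2
    refine ⟨by linarith, fun t ht => ?_⟩
    by_cases htS : t ∈ S
    · rcases hj t htS with h | h
      · linarith
      · exact absurd (Finset.mem_filter.2 ⟨htS, h⟩) ht
    · rw [hS t htS]
      linarith

theorem PartitionOfUnity.exists_mem_dominantSet {X : Type*} [TopologicalSpace X] {𝒱 : Set (Set X)}
    (f : PartitionOfUnity 𝒱 X) (hf : f.IsSubordinate fun V => V) {k : ℕ} {c : ℝ} (hc : 0 < c)
    (hkc : k * (k * c) ≤ 1) {x : X} (hx : {V ∈ 𝒱 | x ∈ V}.encard ≤ k) :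
    ∃ A : Finset 𝒱, A.Nonempty ∧ A.card ≤ k ∧ x ∈ f.dominantSet c A := by
  have hencard : (Function.support fun V => f V x).encard ≤ k := by
    rw [← Subtype.val_injective.encard_image]
    refine (Set.encard_le_encard ?_).trans hx
    rintro _ ⟨V, hV, rfl⟩
    exact ⟨V.2, hf V (subset_tsupport _ hV)⟩
  have hfin := Set.finite_of_encard_le_coe hencard
  refine exists_dominant_finset (S := hfin.toFinset) hc hkc (fun V hV => ?_) ?_ ?_
  · simpa using hV
  · rw [hfin.encard_eq_coe_toFinset_card] at hencard
    exact_mod_cast hencard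
  · rw [← f.sum_eq_one (Set.mem_univ x)]
    exact (finsum_eq_sum_of_support_subset _ (by simp)).symm

theorem HasCoveringDimensionLT.exists_separated_families {X : Type*} [MetricSpace X] {k : ℕ}
    (h : HasCoveringDimensionLT X k) {D : X → X → ℝ} (hD : IsContinuousPseudometric D)
    {δ : ℝ} (hδ : 0 < δ) :
    ∃ (T : Fin k → Set (Set X)) (D' : X → X → ℝ), IsContinuousPseudometric D' ∧
      (∀ x y, D x y ≤ D' x y) ∧
      (∀ l, ∀ V ∈ T l, IsOpen V ∧ ∀ x ∈ V, ∀ y ∈ V, D x y ≤ δ) ∧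
      (∀ x, ∃ l, ∃ V ∈ T l, x ∈ V) ∧
      ∀ l, ∀ V ∈ T l, ∀ W ∈ T l, V ≠ W → ∀ x ∈ V, ∀ y ∈ W, 1 ≤ D' x y := by
  obtain ⟨𝒱, ⟨h𝒱o, h𝒱c⟩, href, hord⟩ := h
    (Set.range fun x => interior {y | D x y < δ / 2})
    ⟨by rintro _ ⟨x, rfl⟩; exact isOpen_interior, Set.eq_univ_of_forall fun x =>
      ⟨_, ⟨x, rfl⟩, mem_interior_iff_mem_nhds.2 (hD.eventually_lt x _ (half_pos hδ))⟩⟩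
  have hsmall : ∀ V ∈ 𝒱, ∀ x ∈ V, ∀ y ∈ V, D x y ≤ δ := by
    intro V hV x hx y hy
    obtain ⟨_, ⟨z, rfl⟩, hVz⟩ := href V hV
    have h1 : x ∈ {y | D z y < δ / 2} := interior_subset (hVz hx)
    have h2 : y ∈ {y | D z y < δ / 2} := interior_subset (hVz hy)
    rw [Set.mem_ofPred_eq] at h1 h2
    have h3 := hD.triangle x z y
    rw [hD.symm x z] at h3
    linarith
  obtain ⟨f, hf⟩ := PartitionOfUnity.exists_isSubordinate isClosed_univ (fun V : 𝒱 => (V : Set X))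
    (fun V => h𝒱o V V.2) (by rw [← Set.sUnion_eq_iUnion, h𝒱c])
  -- Any `η > 0` with `k * (k * (2 * η)) ≤ 1` will do.
  obtain ⟨η, hη, hkη⟩ : ∃ η : ℝ, 0 < η ∧ k * (k * (2 * η)) ≤ 1 := by
    refine ⟨1 / (2 * (k + 1) ^ 2), by positivity, ?_⟩
    rw [show (k : ℝ) * (k * (2 * (1 / (2 * (k + 1) ^ 2)))) = k ^ 2 / (k + 1) ^ 2 by field_simp]
    rw [div_le_one (by positivity)]
    gcongr
    linarith
  refine ⟨fun l => {V | ∃ A : Finset 𝒱, A.card = l + 1 ∧ interior (f.dominantSet η A) = V},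
    fun x y => max (D x y) (f.supDist x y / η),
    hD.max (f.isContinuousPseudometric_supDist.div_const hη), fun x y => le_max_left _ _, ?_,
    fun x => ?_, ?_⟩
  · rintro l _ ⟨A, hA, rfl⟩
    obtain ⟨V, hV⟩ : A.Nonempty := by
      rw [← Finset.card_pos]
      omega
    have hsub : interior (f.dominantSet η A) ⊆ V := fun x hx =>
      hf V (subset_tsupport _ (hη.trans_le (interior_subset hx V hV).1).ne')
    exact ⟨isOpen_interior, fun x hx y hy => hsmall V V.2 x (hsub hx) y (hsub hy)⟩
  · obtain ⟨A, hne, hcard, hx⟩ :=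
      f.exists_mem_dominantSet hf (by positivity : 0 < 2 * η) hkη (hord x)
    have hpos := hne.card_pos
    exact ⟨⟨A.card - 1, by omega⟩, _, ⟨A, (Nat.sub_add_cancel hpos).symm, rfl⟩,
      f.dominantSet_subset_interior hη A hx⟩
  · rintro l _ ⟨A, hA, rfl⟩ _ ⟨B, hB, rfl⟩ hne x hx y hy
    refine le_max_of_le_right ((one_le_div hη).2 ?_)
    exact f.le_supDist_of_mem_dominantSet (hA.trans hB.symm) (fun hAB => hne (by rw [hAB]))
      (interior_subset hx) (interior_subset hy)

/-! ### Chains of small sets -/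

/-- `ChainRel T i N x y` says that `x` and `y` are joined by a finite chain of sets from the
families `T j` with `i ≤ j < N`. -/
def ChainRel {X : Type*} (T : ℕ → Set (Set X)) (i N : ℕ) : X → X → Prop :=
  Relation.ReflTransGen fun x y => ∃ j, i ≤ j ∧ j < N ∧ ∃ V ∈ T j, x ∈ V ∧ y ∈ V

theorem ChainRel.mono {X : Type*} {T : ℕ → Set (Set X)} {i i' N N' : ℕ} (hi : i' ≤ i)
    (hN : N ≤ N') {x y : X} (h : ChainRel T i N x y) : ChainRel T i' N' x y :=
  Relation.ReflTransGen.mono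
    (fun _ _ ⟨j, h1, h2, h3⟩ => ⟨j, hi.trans h1, h2.trans_le hN, h3⟩) _ _ h

theorem ChainRel.symm {X : Type*} {T : ℕ → Set (Set X)} {i N : ℕ} {x y : X}
    (h : ChainRel T i N x y) : ChainRel T i N y x :=
  (@Relation.ReflTransGen.stdSymm _ _
    ⟨fun _ _ ⟨j, h1, h2, V, hV, hx, hy⟩ => ⟨j, h1, h2, V, hV, hy, hx⟩⟩).symm _ _ h

/-- A chain meets the lowest level in at most one set if shorter chains cannot connect two
different sets of that level. -/
theorem ChainRel.succ_or_exists {X : Type*} {T : ℕ → Set (Set X)} {i N : ℕ}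
    (hsep : ∀ V ∈ T i, ∀ W ∈ T i, ∀ x ∈ V, ∀ y ∈ W, ChainRel T (i + 1) N x y → V = W)
    {x y : X} (h : ChainRel T i N x y) :
    ChainRel T (i + 1) N x y ∨ ∃ V ∈ T i, ∃ a ∈ V, ∃ b ∈ V,
      ChainRel T (i + 1) N x a ∧ ChainRel T (i + 1) N b y := by
  induction h with
  | refl => exact Or.inl .refl
  | tail _ hyz ih =>
    obtain ⟨j, hij, hjN, W, hW, hy, hz⟩ := hyz
    rcases hij.eq_or_lt with rfl | hij
    · right
      rcases ih with ih | ⟨V, hV, a, ha, b, hb, hxa, hby⟩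
      · exact ⟨W, hW, _, hy, _, hz, ih, .refl⟩
      · obtain rfl := hsep V hV W hW b hb _ hy hby
        exact ⟨V, hV, a, ha, _, hz, hxa, .refl⟩
    · rcases ih with ih | ⟨V, hV, a, ha, b, hb, hxa, hby⟩
      · exact Or.inl (ih.tail ⟨j, hij, hjN, W, hW, hy, hz⟩)
      · exact Or.inr ⟨V, hV, a, ha, b, hb, hxa, hby.tail ⟨j, hij, hjN, W, hW, hy, hz⟩⟩

/-- Chains are short. The proof is by downward induction on the lowest level `i`: a chain consists
of at most one set of level `i`, of diameter at most `ε i / 2`, between two chains of higher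
levels, of diameters at most `ε (i + 1) = ε i / 4`. -/
theorem ChainRel.le_of_separated {X : Type*} {T : ℕ → Set (Set X)} {D : ℕ → X → X → ℝ}
    {ε : ℕ → ℝ} (hε : ∀ i, 0 < ε i) (hε1 : ∀ i, ε i < 1) (hε4 : ∀ i, ε (i + 1) = ε i / 4)
    (hself : ∀ i x, D i x x = 0) (htri : ∀ i x y z, D i x z ≤ D i x y + D i y z)
    (hmono : ∀ i x y, D i x y ≤ D (i + 1) x y)
    (hsmall : ∀ i, ∀ V ∈ T i, ∀ x ∈ V, ∀ y ∈ V, D i x y ≤ ε i / 2)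
    (hsep : ∀ i, ∀ V ∈ T i, ∀ W ∈ T i, V ≠ W → ∀ x ∈ V, ∀ y ∈ W, 1 ≤ D (i + 1) x y)
    {i N : ℕ} {x y : X} (h : ChainRel T i N x y) : D i x y ≤ ε i := by
  induction hm : N - i generalizing i x y with
  | zero =>
    have hxy : x = y := by
      induction h with
      | refl => rfl
      | tail _ hyz _ =>
        obtain ⟨j, h1, h2, -⟩ := hyz
        omega
    rw [hxy, hself]
    exact (hε i).le
  | succ m ih =>
    have ih' : ∀ {a b : X}, ChainRel T (i + 1) N a b → D (i + 1) a b ≤ ε (i + 1) :=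
      fun hab => ih hab (by omega)
    have hpos := hε i
    rcases h.succ_or_exists fun V hV W hW a ha b hb hab => by
      by_contra hne
      linarith [hsep i V hV W hW hne a ha b hb, ih' hab, hε1 (i + 1)] with
      hxy | ⟨V, hV, a, ha, b, hb, hxa, hby⟩
    · linarith [hmono i x y, ih' hxy, hε4 i]
    · linarith [htri i x a y, htri i a b y, hmono i x a, hmono i b y, ih' hxa, ih' hby,
        hsmall i V hV a ha b hb, hε4 i]

/-- The equivalence relation generated by lying in a common member of one of the families `T j`
with `i ≤ j`. -/
def chainSetoid {X : Type*} (T : ℕ → Set (Set X)) (i : ℕ) : Setoid X where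
  r x y := ∃ N, ChainRel T i N x y
  iseqv :=
    { refl := fun _ => ⟨0, .refl⟩
      symm := fun ⟨N, h⟩ => ⟨N, h.symm⟩
      trans := fun ⟨N, h⟩ ⟨M, h'⟩ => ⟨max N M,
        (h.mono le_rfl (le_max_left _ _)).trans (h'.mono le_rfl (le_max_right _ _))⟩ }

theorem chainSetoid_of_mem {X : Type*} {T : ℕ → Set (Set X)} {i j : ℕ} (hij : i ≤ j) {V : Set X}
    (hV : V ∈ T j) {x y : X} (hx : x ∈ V) (hy : y ∈ V) : chainSetoid T i x y :=
  ⟨j + 1, .single ⟨j, hij, j.lt_succ_self, V, hV, hx, hy⟩⟩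

theorem chainSetoid_antitone {X : Type*} (T : ℕ → Set (Set X)) : Antitone (chainSetoid T) :=
  fun _ _ hij _ _ ⟨N, h⟩ => ⟨N, h.mono hij le_rfl⟩

theorem isOpen_chainSetoid_class {X : Type*} [TopologicalSpace X] {T : ℕ → Set (Set X)}
    (hT : ∀ i, ∀ V ∈ T i, IsOpen V) {i j : ℕ} (hij : i ≤ j) {V : Set X} (hV : V ∈ T j) {x : X}
    (hx : x ∈ V) : IsOpen {y | chainSetoid T i x y} := by
  refine isOpen_iff_mem_nhds.2 fun y hy => ?_
  -- The last set of a chain from `x` to `y`, or `V` for the trivial chain, contains `y`.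
  obtain ⟨j', hij', W, hW, hyW⟩ : ∃ j', i ≤ j' ∧ ∃ W ∈ T j', y ∈ W := by
    obtain ⟨N, hN⟩ := hy
    rcases Relation.ReflTransGen.cases_tail hN with rfl | ⟨_, -, j', h1, -, W, hW, -, hyW⟩
    · exact ⟨j, hij, V, hV, hx⟩
    · exact ⟨j', h1, W, hW, hyW⟩
  filter_upwards [(hT j' W hW).mem_nhds hyW] with z hz
  exact (chainSetoid T i).trans hy (chainSetoid_of_mem hij' hW hyW hz)

/-! ### The winning strategy -/

/-- A metric space of covering dimension less than `k` is the union of `k` sets, each of which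
consists of the points at which a decreasing sequence of equivalence relations with small classes
has only open classes. -/
theorem HasCoveringDimensionLT.exists_equivalences {X : Type*} [MetricSpace X] {k : ℕ}
    (h : HasCoveringDimensionLT X k) :
    ∃ E : Fin k → ℕ → Setoid X, (∀ l, Antitone (E l)) ∧
      (∀ r > 0, ∃ i, ∀ l x y, E l i x y → dist x y < r) ∧
      ∀ x, ∃ l, ∀ i, IsOpen {y | E l i x y} := by
  obtain ⟨ε, hε, hε1, hε4, hεlim⟩ : ∃ ε : ℕ → ℝ, (∀ i, 0 < ε i) ∧ (∀ i, ε i < 1) ∧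
      (∀ i, ε (i + 1) = ε i / 4) ∧ Tendsto ε atTop (𝓝 0) := by
    refine ⟨fun i => 1 / 2 * (1 / 4) ^ i, fun i => by positivity, fun i => ?_, fun i => by ring, ?_⟩
    · have : (1 / 4 : ℝ) ^ i ≤ 1 := pow_le_one₀ (by norm_num) (by norm_num)
      linarith
    · simpa only [mul_zero] using (tendsto_pow_atTop_nhds_zero_of_lt_one (r := (1 / 4 : ℝ))
        (by norm_num) (by norm_num)).const_mul (1 / 2)
  choose T D' hD' hmono hT hcov hsep using
    fun (D : {D : X → X → ℝ // IsContinuousPseudometric D}) (i : ℕ) =>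
      h.exists_separated_families D.2 (half_pos (hε i))
  let D : ℕ → {D : X → X → ℝ // IsContinuousPseudometric D} := fun i =>
    Nat.rec ⟨dist, isContinuousPseudometric_dist⟩ (fun i D => ⟨D' D i, hD' D i⟩) i
  have hdist : ∀ i x y, dist x y ≤ (D i).1 x y := by
    intro i x y
    induction i with
    | zero => exact le_rfl
    | succ i ih => exact ih.trans (hmono (D i) i x y)
  refine ⟨fun l => chainSetoid fun i => T (D i) i l, fun l => chainSetoid_antitone _, ?_, ?_⟩
  · intro r hr
    obtain ⟨i, hi⟩ := (hεlim.eventually_lt_const hr).exists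
    refine ⟨i, fun l x y ⟨N, hN⟩ => ((hdist i x y).trans ?_).trans_lt hi⟩
    exact hN.le_of_separated (D := fun i => (D i).1) hε hε1 hε4 (fun i => (D i).2.self)
      (fun i => (D i).2.triangle) (fun i => hmono (D i) i) (fun i V hV => (hT (D i) i l V hV).2)
      (fun i => hsep (D i) i l)
  · intro x
    choose c V hV hx using fun i => hcov (D i) i x
    -- Some colour is used at infinitely many levels.
    obtain ⟨l, hl⟩ := Finite.exists_infinite_fiber c
    refine ⟨l, fun i => ?_⟩
    obtain ⟨j, hj, hij⟩ := (Set.infinite_coe_iff.1 hl).exists_gt i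
    obtain rfl : c j = l := hj
    exact isOpen_chainSetoid_class (T := fun i => T (D i) i (c j)) (fun i V hV => (hT (D i) i _ V hV).1)
      hij.le (hV j) (hx j)

/-- The classes of the relations `E i` that are open, contained in a member of `𝒰`, and not
contained in a class of an earlier relation with the latter property. -/
def maximalClasses {X : Type*} [TopologicalSpace X] (E : ℕ → Setoid X) (𝒰 : Set (Set X)) :
    Set (Set X) :=
  {V | IsOpen V ∧ ∃ x i, V = {y | E i x y} ∧ (∃ U ∈ 𝒰, V ⊆ U) ∧
    ∀ j < i, ¬ ∃ U ∈ 𝒰, {y | E j x y} ⊆ U}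

theorem pairwiseDisjoint_maximalClasses {X : Type*} [TopologicalSpace X] {E : ℕ → Setoid X}
    (hE : Antitone E) (𝒰 : Set (Set X)) : (maximalClasses E 𝒰).PairwiseDisjoint id := by
  have hclass : ∀ {i x z}, E i x z → {y | E i x y} = {y | E i z y} := fun {i x z} hxz =>
    Set.ext fun y => ⟨(E i).trans ((E i).symm hxz), (E i).trans hxz⟩
  rintro _ ⟨-, x, i, rfl, hxi, hxmin⟩ _ ⟨-, x', i', rfl, hxi', hxmin'⟩ hne
  refine Set.disjoint_left.2 fun z (hz : E i x z) (hz' : E i' x' z) => hne ?_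
  rw [hclass hz] at hxi ⊢
  rw [hclass hz'] at hxi' ⊢
  obtain hlt | rfl | hlt := lt_trichotomy i i'
  · refine absurd ?_ (hxmin' i hlt)
    rwa [hclass (hE hlt.le hz')]
  · rfl
  · refine absurd ?_ (hxmin i' hlt)
    rwa [hclass (hE hlt.le hz)]

theorem exists_mem_maximalClasses {X : Type*} [MetricSpace X] {E : ℕ → Setoid X}
    (hE : ∀ r > 0, ∃ i, ∀ x y, E i x y → dist x y < r) {𝒰 : Set (Set X)} (h𝒰 : 𝒰 ∈ openCovers X)
    {x : X} (hx : ∀ i, IsOpen {y | E i x y}) : ∃ V ∈ maximalClasses E 𝒰, x ∈ V := by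
  classical
  have hex : ∃ i, ∃ U ∈ 𝒰, {y | E i x y} ⊆ U := by
    obtain ⟨U, hU, hxU⟩ : x ∈ ⋃₀ 𝒰 := h𝒰.2 ▸ Set.mem_univ x
    obtain ⟨r, hr, hball⟩ := Metric.isOpen_iff.1 (h𝒰.1 U hU) x hxU
    obtain ⟨i, hi⟩ := hE r hr
    exact ⟨i, U, hU, fun y hy => hball (by rw [Metric.mem_ball, dist_comm]; exact hi x y hy)⟩
  exact ⟨_, ⟨hx _, x, Nat.find hex, rfl, Nat.find_spec hex, fun _ => Nat.find_min hex⟩,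
    (E _).refl x⟩

theorem HasCoveringDimensionLT.twoWinsGc {X : Type*} [MetricSpace X] {k : ℕ}
    (h : HasCoveringDimensionLT X k) : TwoWinsGc k (openCovers X) (openCovers X) := by
  obtain ⟨E, hanti, hsmall, hopen⟩ := h.exists_equivalences
  refine ⟨fun l O => maximalClasses (E l) (O ⟨l, Set.mem_Iic.2 le_rfl⟩), fun O hO => ⟨fun l => ⟨?_, ?_⟩, ?_, ?_⟩⟩
  · exact pairwiseDisjoint_maximalClasses (hanti l) _
  · rintro V ⟨-, x, i, -, hV, -⟩
    exact hV
  · intro V hV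
    obtain ⟨l, hl⟩ := Set.mem_iUnion.1 hV
    exact hl.1
  · refine Set.eq_univ_of_forall fun x => ?_
    obtain ⟨l, hl⟩ := hopen x
    obtain ⟨V, hV, hxV⟩ := exists_mem_maximalClasses (fun r hr => (hsmall r hr).imp fun _ hi => hi l)
      (hO l) hl
    exact ⟨V, Set.mem_iUnion.2 ⟨l, hV⟩, hxV⟩

theorem TwoWinsGc.hasCoveringDimensionLT {X : Type*} [TopologicalSpace X] {k : ℕ}
    (h : TwoWinsGc k (openCovers X) (openCovers X)) : HasCoveringDimensionLT X k := by
  obtain ⟨σ, hσ⟩ := h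
  intro 𝒰 h𝒰
  obtain ⟨hlegal, hwin⟩ := hσ (fun _ => 𝒰) fun _ => h𝒰
  refine ⟨_, hwin, fun V hV => ?_, fun x => ?_⟩
  · obtain ⟨l, hl⟩ := Set.mem_iUnion.1 hV
    exact (hlegal l).2 V hl
  · -- Sending a member that contains `x` to an inning in which it was played is injective.
    choose c hc using fun V : {V ∈ ⋃ l, σ l fun _ => 𝒰 | x ∈ V} => Set.mem_iUnion.1 V.2.1
    have hinj : Function.Injective c := fun V W hVW =>
      Subtype.ext ((hlegal (c V)).1.elim (hc V) (hVW ▸ hc W)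
        (Set.not_disjoint_iff.2 ⟨x, V.2.2, W.2.2⟩))
    calc {V ∈ ⋃ l, σ l fun _ => 𝒰 | x ∈ V}.encard
        ≤ ENat.card (Fin k) := ENat.card_le_card_of_injective hinj
      _ = k := by simp

theorem mainTheorem2 (X : Type*) [MetricSpace X] (n : ℕ) :
    (coveringDimension X ≤ (n : WithBot ℕ∞) ↔
      TwoWinsGc (n + 1) (openCovers X) (openCovers X)) ∧
    (coveringDimension X = (n : WithBot ℕ∞) ↔
      TwoWinsGc (n + 1) (openCovers X) (openCovers X) ∧
        ¬ TwoWinsGc n (openCovers X) (openCovers X)) := by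
  have hlt : ∀ k : ℕ, coveringDimension X < (k : WithBot ℕ∞) ↔
      TwoWinsGc k (openCovers X) (openCovers X) := fun k =>
    coveringDimension_lt_iff.trans
      ⟨HasCoveringDimensionLT.twoWinsGc, TwoWinsGc.hasCoveringDimensionLT⟩
  have hle : coveringDimension X ≤ (n : WithBot ℕ∞) ↔
      TwoWinsGc (n + 1) (openCovers X) (openCovers X) := by
    rw [← hlt, Nat.cast_add, Nat.cast_one, ENat.WithBot.lt_add_one_iff]
  refine ⟨hle, ?_⟩
  rw [← hle, ← hlt, not_lt]
  exact le_antisymm_iff
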